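/- \textbf{Sampled transformers are universal approximators.} Let $d\ge 0$, $2\le n_s\le n$ and $l$ be integers with $(n_s-1)\,l=n$. Fix any realization of the random element sampling, that is, pairwise disjoint ordered index sets $\mathcal R^1,\dots,\mathcal R^l\subset[n]$ with $|\mathcal R^i|=n_s-1$; the $i$-th sub-sample $\mathsf X^i\in\mathbb R^{d\times n_s}$ of $X\in\mathbb R^{d\times n}$ consists of the columns of $X$ with indices in $\mathcal R^i$, in order, followed by the column whose index is the first element of $\mathcal R^{\gamma(i)}$, where $\gamma(i)=1+(i \bmod l)$. Fix also the coordinate matrix $P\in\mathbb R^{3\times n}$ of $n$ distinct points. A \emph{sampled transformer block} with $h$ heads of size $m$ and hidden width $r$ has parameters $W_V^j,W_K^j,W_Q^j\in\mathbb R^{m\times d}$ ($1\le j\le h$), $W_O\in\mathbb R^{d\times mh}$, $W_1\in\mathbb R^{r\times d}$, $b_1\in\mathbb R^r$, $W_2\in\mathbb R^{d\times r}$, $b_2\in\mathbb R^d$. With the Hamiltonian attention pattern $\mathcal A_k=\{k,k+1\}$ for $k<n_s$ and $\mathcal A_{n_s}=\{n_s\}$, and $\sigma_S$ the softmax, put $$\mathrm{SHead}^j_k(Y)=(W_V^jY_{\mathcal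 A_k})\,\sigma_S\big[(W_K^jY_{\mathcal A_k})^TW_Q^jY_k\big],\qquad g(Y)=Y+W_O\begin{bmatrix}\mathrm{SHead}^1(Y)\\ \vdots\\ \mathrm{SHead}^h(Y)\end{bmatrix}\qquad(Y\in\mathbb R^{d\times n_s}).$$ $\mathrm{SAttn}(X)$ is obtained from $X$ by replacing, successively for $i=1,\dots,l$, the columns of the current matrix that form its $i$-th sub-sample by the columns of $g$ of that sub-sample. The block maps $X$ to $Z+W_2\,\mathrm{ReLU}(W_1Z+b_1\mathbf 1_n^T)+b_2\mathbf 1_n^T$ with $Z=\mathrm{SAttn}(X)$. Let $\mathcal{ST}^{h,m,r}$ be the class of all maps $X\mapsto t(X+W_pP)$, where $W_p\in\mathbb R^{d\times 3}$ and $t$ is a composition of any finite number of such blocks, each with its own parameters. Then for every $1\le p<\infty$, every $\varepsilon>0$, every compact set $D\subset\mathbb R^{d\times n}$ and every continuous $f:D\to\mathbb R^{d\times n}$ (in particular every continuous set-to-set, i.e. permutation equivariant, function) there is $g\in\mathcal{ST}^{2,1,4}$ such that $$d_p(f,g)=\Big(\int_D\|f(X)-g(X)\|_p^p\,dX\Big)^{1/p}\le\varepsilon,$$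 where $\|\cdot\|_p$ is the entry-wise $p$-norm. -/

import Mathlib

open MeasureTheory
open scoped ENNReal

noncomputable section

namespace SampledTransformer

/-- A realization of random element sampling: `l` pairwise disjoint ordered index sets
`R 0, …, R (l - 1)` in `{0, …, n - 1}`, each with `nₛ - 1` distinct entries, where
`2 ≤ nₛ ≤ n` and `(nₛ - 1) * l = n` (so together they exhaust all `n` points). -/
structure Sampling (n nₛ l : ℕ) where
  two_le : 2 ≤ nₛ
  le : nₛ ≤ n
  card : (nₛ - 1) * l = n
  R : Fin l → Fin (nₛ - 1) → Fin n
  distinct : ∀ i i' k k', R i k = R i' k' → i = i' ∧ k = k'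

variable {n nₛ l : ℕ}

/-- The cycle function on the subsets: `i ↦ i + 1`, wrapping around at the end. -/
def Sampling.next (_S : Sampling n nₛ l) (i : Fin l) : Fin l :=
  ⟨(i.val + 1) % l, Nat.mod_lt _ (Nat.zero_lt_of_lt i.isLt)⟩

/-- The first index of the `i`-th ordered index set. -/
def Sampling.first (S : Sampling n nₛ l) (i : Fin l) : Fin n :=
  S.R i ⟨0, Nat.sub_pos_of_lt S.two_le⟩

/-- The `nₛ` indices of the `i`-th sub-sample: the ordered set `R i`, followed by the first
index of the next set. -/
def Sampling.window (S : Sampling n nₛ l) (i : Fin l) (k : Fin nₛ) : Fin n :=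
  if hk : k.val < nₛ - 1 then S.R i ⟨k.val, hk⟩ else S.first (S.next i)

/-- The columns of a sub-sample are distinct points. -/
theorem Sampling.window_injective (S : Sampling n nₛ l) (i : Fin l) :
    Function.Injective (S.window i) := by
  have hl : 2 ≤ l := by
    have h1 := S.two_le
    have h2 := S.le
    have h3 := S.card
    by_contra hcon
    have hi := i.isLt
    have hl1 : l = 1 := by omega
    rw [hl1] at h3
    omega
  have hne : S.next i ≠ i := by
    intro h
    have hv : (i.val + 1) % l = i.val := congrArg Fin.val h
    have hi := i.isLt
    rcases Nat.lt_or_ge (i.val + 1) l with h' | h'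
    · rw [Nat.mod_eq_of_lt h'] at hv
      omega
    · have : i.val + 1 = l := by omega
      rw [this, Nat.mod_self] at hv
      omega
  intro k k' h
  have hk := k.isLt
  have hk' := k'.isLt
  unfold Sampling.window Sampling.first at h
  split_ifs at h with h1 h2 h2
  · have := (S.distinct _ _ _ _ h).2
    exact Fin.ext (by simpa using this)
  · exact absurd (S.distinct _ _ _ _ h).1.symm hne
  · exact absurd (S.distinct _ _ _ _ h).1 hne
  · exact Fin.ext (by omega)

/-- The Hamiltonian (path) attention pattern: token `k` uses the tokens `k` and `k + 1`, and the
last token uses only itself. -/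
def hamiltonianPattern (k : Fin nₛ) : Finset (Fin nₛ) :=
  Finset.univ.filter fun j => j.val = k.val ∨ j.val = k.val + 1

/-- Softmax of the scores `v` over the index set `A`. -/
def softmaxOn {ι : Type*} (A : Finset ι) (v : ι → ℝ) (j : ι) : ℝ :=
  Real.exp (v j) / ∑ i ∈ A, Real.exp (v i)

/-- Parameters of a transformer block with `h` heads of size `m` and hidden layer width `r`,
on tokens with `d` features. -/
structure BlockParams (d h m r : ℕ) where
  WV : Fin h → Matrix (Fin m) (Fin d) ℝ
  WK : Fin h → Matrix (Fin m) (Fin d) ℝ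
  WQ : Fin h → Matrix (Fin m) (Fin d) ℝ
  WO : Matrix (Fin d) (Fin h × Fin m) ℝ
  W₁ : Matrix (Fin r) (Fin d) ℝ
  b₁ : Fin r → ℝ
  W₂ : Matrix (Fin d) (Fin r) ℝ
  b₂ : Fin d → ℝ

variable {d h m r : ℕ}

/-- The `j`-th sparse attention head on a sub-sample `Y` (one column for each token). -/
def sHead (θ : BlockParams d h m r) (j : Fin h) (Y : Matrix (Fin d) (Fin nₛ) ℝ) :
    Matrix (Fin m) (Fin nₛ) ℝ :=
  Matrix.of fun a k => ∑ i ∈ hamiltonianPattern k,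
    (θ.WV j * Y) a i *
      softmaxOn (hamiltonianPattern k) (fun i' => ((θ.WK j * Y).transpose * (θ.WQ j * Y)) i' k) i

/-- Multi-head Hamiltonian self-attention on a sub-sample, with skip connection; the outputs of
the heads are stacked. -/
def subAttn (θ : BlockParams d h m r) (Y : Matrix (Fin d) (Fin nₛ) ℝ) :
    Matrix (Fin d) (Fin nₛ) ℝ :=
  Y + θ.WO * Matrix.of fun (q : Fin h × Fin m) k => sHead θ q.1 Y q.2 k

/-- Apply the attention layer to the `i`-th sub-sample of `X` and write the new columns back
into `X`; all other columns are kept. -/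
def sampledStep (θ : BlockParams d h m r) (S : Sampling n nₛ l) (i : Fin l)
    (X : Matrix (Fin d) (Fin n) ℝ) : Matrix (Fin d) (Fin n) ℝ :=
  Matrix.of fun a => Function.extend (S.window i)
    (subAttn θ (X.submatrix id (S.window i)) a) (X a)

/-- Sampled attention: the sub-samples are processed one after the other, with shared
parameters, starting with the first. -/
def sAttn (θ : BlockParams d h m r) (S : Sampling n nₛ l) (X : Matrix (Fin d) (Fin n) ℝ) :
    Matrix (Fin d) (Fin n) ℝ :=
  (List.finRange l).foldl (fun Y i => sampledStep θ S i Y) X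

/-- The token-wise ReLU feed-forward layer, with skip connection and bias vectors. -/
def feedForward (θ : BlockParams d h m r) (Z : Matrix (Fin d) (Fin n) ℝ) :
    Matrix (Fin d) (Fin n) ℝ :=
  Z + θ.W₂ * (θ.W₁ * Z + Matrix.of fun a _ => θ.b₁ a).map (fun t => max t 0)
    + Matrix.of fun a _ => θ.b₂ a

/-- The sampled transformer block. -/
def stb (θ : BlockParams d h m r) (S : Sampling n nₛ l) (X : Matrix (Fin d) (Fin n) ℝ) :
    Matrix (Fin d) (Fin n) ℝ :=
  feedForward θ (sAttn θ S X)

/-- The functions computed by sampled transformers for the sampling `S` and the matrix `P` of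
`xyz` coordinates: the positional embedding `Wp * P` is added to the input, and then any finite
number of sampled transformer blocks with `h` heads of size `m` and hidden layer width `r` is
applied. The parameters are `Wp` and the parameters of the blocks. -/
def sampledTransformers (S : Sampling n nₛ l) (P : Matrix (Fin 3) (Fin n) ℝ) (d h m r : ℕ) :
    Set (Matrix (Fin d) (Fin n) ℝ → Matrix (Fin d) (Fin n) ℝ) :=
  {g | ∃ (Wp : Matrix (Fin d) (Fin 3) ℝ) (blocks : List (BlockParams d h m r)),
    ∀ X, g X = blocks.foldl (fun Y θ => stb θ S Y) (X + Wp * P)}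

/-- The `ℓ_p` distance of `f₁` and `f₂` on `D`: the integral of the entry-wise `p`-th power of
the difference over `D` (Lebesgue measure on the `d * n` entries), to the power `1 / p`. -/
def lpDist (p : ℝ) (D : Set (Matrix (Fin d) (Fin n) ℝ))
    (f₁ f₂ : Matrix (Fin d) (Fin n) ℝ → Matrix (Fin d) (Fin n) ℝ) : ℝ≥0∞ :=
  (∫⁻ X : Fin d → Fin n → ℝ in Matrix.of ⁻¹' D,
    ENNReal.ofReal (∑ a, ∑ k, |f₁ (Matrix.of X) a k - f₂ (Matrix.of X) a k| ^ p)) ^ (1 / p)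

end SampledTransformer

end

/-! The target is approximated by a map that is constant on the cells of a fine grid, up to narrow
gaps between cells. Uniform continuity of `f` controls the error off the gaps. On the gaps the
output is clipped to the bound of `f`, and their measure inside the compact `D` can be made as small
as needed. Feed-forward layers, with attention switched off, round every entry to the grid and clip
the output; three ReLU units suffice for each such layer. What remains is interpolation on finitely
many grid matrices, whose columns in different positions differ because the positional embedding
pushes the positions apart.

For this (`Realizable.interpolate`), each column must come to determine its position and the whole
matrix; a token-wise network (`TokenNet.interpolate`) then sends it to the prescribed value. The
tokens are first coded by distinct numbers in one row. Attention with zero keys and queries adds `t`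
times a neighbourhood mean to this row. For small `t ≠ 0`, entries that differed stay different, and
equal entries split to first order when their successors differ (`exists_meanPass_separates`). Each
window ends at the start of the next index set, so successors run through a cycle of all positions;
repeated passes carry the information all the way round. One head is enough, and it only averages.
-/

namespace SampledTransformer

/-! ### Realizable maps and token-wise networks -/

/-- The maps computed by finite stacks of blocks with two heads of size one and hidden width
four. -/
def Realizable {n nₛ l d : ℕ} (S : Sampling n nₛ l)
    (g : Matrix (Fin d) (Fin n) ℝ → Matrix (Fin d) (Fin n) ℝ) : Prop :=
  ∃ blocks : List (BlockParams d 2 1 4), ∀ X, blocks.foldl (fun Y θ => stb θ S Y) X = g X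

theorem Realizable.id {n nₛ l d : ℕ} (S : Sampling n nₛ l) :
    Realizable (d := d) S (fun X => X) :=
  ⟨[], fun _ => rfl⟩

theorem Realizable.comp {n nₛ l d : ℕ} {S : Sampling n nₛ l}
    {g g' : Matrix (Fin d) (Fin n) ℝ → Matrix (Fin d) (Fin n) ℝ}
    (hg' : Realizable S g') (hg : Realizable S g) : Realizable S (fun X => g' (g X)) := by
  obtain ⟨b, hb⟩ := hg
  obtain ⟨b', hb'⟩ := hg'
  exact ⟨b ++ b', fun X => by rw [List.foldl_append, hb, hb']⟩

/-- Apply a map to every column of a matrix. -/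
def colMap {d n : ℕ} (φ : (Fin d → ℝ) → Fin d → ℝ) (X : Matrix (Fin d) (Fin n) ℝ) :
    Matrix (Fin d) (Fin n) ℝ :=
  Matrix.of fun a k => φ (X.col k) a

/-- The maps of tokens whose column-wise application is realizable. -/
def TokenNet {n nₛ l d : ℕ} (S : Sampling n nₛ l) (φ : (Fin d → ℝ) → Fin d → ℝ) : Prop :=
  Realizable S (colMap φ)

theorem TokenNet.id {n nₛ l d : ℕ} (S : Sampling n nₛ l) :
    TokenNet (d := d) S (fun x => x) :=
  Realizable.id S

theorem TokenNet.comp {n nₛ l d : ℕ} {S : Sampling n nₛ l}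
    {φ φ' : (Fin d → ℝ) → Fin d → ℝ} (h' : TokenNet S φ') (h : TokenNet S φ) :
    TokenNet S (fun x => φ' (φ x)) :=
  Realizable.comp (g' := colMap φ') (g := colMap φ) h' h

/-- Functions of one variable computed by a hidden layer of four ReLU units. -/
def FourReLU (h : ℝ → ℝ) : Prop :=
  ∃ w s b : Fin 4 → ℝ, ∀ x, h x = ∑ j, w j * max (s j * x + b j) 0

/-- Only the skip connection survives, so the block reduces to its feed-forward layer. -/
theorem sAttn_of_WO_eq_zero {n nₛ l d h m r : ℕ} (S : Sampling n nₛ l) (θ : BlockParams d h m r)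
    (hθ : θ.WO = 0) (X : Matrix (Fin d) (Fin n) ℝ) : sAttn θ S X = X := by
  have hstep : ∀ i Y, sampledStep θ S i Y = Y := by
    intro i Y
    ext a k
    simp only [sampledStep, subAttn, hθ, Matrix.zero_mul, add_zero, Matrix.of_apply]
    by_cases hk : ∃ j, S.window i j = k
    · obtain ⟨j, rfl⟩ := hk
      rw [(S.window_injective i).extend_apply]
      rfl
    · rw [Function.extend_apply' _ _ _ hk]
  unfold sAttn
  generalize List.finRange l = L
  induction L with
  | nil => rfl
  | cons i L ih => rw [List.foldl_cons, hstep, ih]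

/-- Adding a multiple of a fixed vector, where the factor is a small ReLU network in a linear
functional of the token, is realized by a single block. -/
theorem TokenNet.ridge {n nₛ l d : ℕ} (S : Sampling n nₛ l) {h : ℝ → ℝ} (hh : FourReLU h)
    (u v : Fin d → ℝ) : TokenNet S (fun x => x + h (u ⬝ᵥ x) • v) := by
  obtain ⟨w, s, b, hw⟩ := hh
  let θ : BlockParams d 2 1 4 :=
    { WV := 0, WK := 0, WQ := 0, WO := 0
      W₁ := Matrix.of fun j c => s j * u c
      b₁ := b
      W₂ := Matrix.of fun a j => v a * w j
      b₂ := 0 }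
  refine ⟨[θ], fun X => ?_⟩
  have hrow : ∀ j k, (θ.W₁ * X) j k = s j * (u ⬝ᵥ X.col k) := by
    intro j k
    simp only [Matrix.mul_apply, dotProduct, Finset.mul_sum, θ, Matrix.of_apply, Matrix.col_apply,
      mul_assoc]
  ext a k
  simp only [List.foldl_cons, List.foldl_nil, stb, sAttn_of_WO_eq_zero S θ rfl, feedForward,
    colMap, Matrix.add_apply, Matrix.of_apply, Pi.add_apply, Pi.smul_apply, hw,
    Matrix.mul_apply (M := θ.W₂), Matrix.map_apply, hrow, smul_eq_mul, Finset.sum_mul]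
  simp only [θ, Matrix.of_apply, Matrix.col_apply, Pi.zero_apply, add_zero]
  congr 1
  exact Finset.sum_congr rfl fun j _ => by ring

/-! ### Clipping and quantization of single coordinates -/

/-- Functions of one variable whose application to any single coordinate is a token net. -/
def ScalarNet {n nₛ l : ℕ} (S : Sampling n nₛ l) (d : ℕ) (ψ : ℝ → ℝ) : Prop :=
  ∀ a : Fin d, TokenNet S (fun x => Function.update x a (ψ (x a)))

theorem ScalarNet.id {n nₛ l : ℕ} (S : Sampling n nₛ l) (d : ℕ) :
    ScalarNet S d (fun x => x) := fun a => by
  simpa using TokenNet.id S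

theorem ScalarNet.comp {n nₛ l d : ℕ} {S : Sampling n nₛ l} {ψ ψ' : ℝ → ℝ}
    (h' : ScalarNet S d ψ') (h : ScalarNet S d ψ) : ScalarNet S d (fun x => ψ' (ψ x)) :=
  fun a => by simpa using (h' a).comp (h a)

theorem ScalarNet.residual {n nₛ l : ℕ} (S : Sampling n nₛ l) (d : ℕ) {h : ℝ → ℝ}
    (hh : FourReLU h) : ScalarNet S d (fun x => x + h x) := fun a => by
  convert TokenNet.ridge S hh (Pi.single a 1) (Pi.single a 1) using 2 with x
  ext c
  by_cases hc : c = a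
  · subst hc; simp
  · simp [hc]

/-- A scalar net can be applied to all coordinates. -/
theorem ScalarNet.tokenNet {n nₛ l d : ℕ} {S : Sampling n nₛ l} {ψ : ℝ → ℝ}
    (h : ScalarNet S d ψ) : TokenNet S (fun (x : Fin d → ℝ) a => ψ (x a)) := by
  have key : ∀ s : Finset (Fin d),
      TokenNet S (fun (x : Fin d → ℝ) a => if a ∈ s then ψ (x a) else x a) := by
    intro s
    induction s using Finset.induction_on with
    | empty => simpa using TokenNet.id S
    | insert a s ha ih =>
      convert (h a).comp ih using 2 with x
      ext c
      by_cases hc : c = a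
      · subst hc; simp [ha]
      · simp [hc]
  simpa using key Finset.univ

/-- Clipping to an interval `[-B, B]` is a scalar net. -/
theorem ScalarNet.clip {n nₛ l : ℕ} (S : Sampling n nₛ l) (d : ℕ) {B : ℝ} (hB : 0 ≤ B) :
    ∃ ψ, ScalarNet S d ψ ∧ (∀ x, |ψ x| ≤ B) ∧ ∀ x, |x| ≤ B → ψ x = x := by
  refine ⟨fun x => x + (-max (x - B) 0 + max (-x - B) 0), ScalarNet.residual S d
    ⟨![-1, 1, 0, 0], ![1, -1, 0, 0], ![-B, -B, 0, 0], fun x => ?_⟩, fun x => ?_, fun x hx => ?_⟩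
  · simp [Fin.sum_univ_four, sub_eq_add_neg]
  · rw [abs_le]
    rcases max_cases (x - B) 0 with h1 | h1 <;> rcases max_cases (-x - B) 0 with h2 | h2 <;>
      constructor <;> linarith
  · rw [abs_le] at hx
    simp only
    rw [max_eq_right (by linarith), max_eq_right (by linarith)]
    ring

/-- Collapsing a cell `[α, α + (1 - γ) η]` to its left end, while fixing all points outside
`(α, α + η)`, is a scalar net. -/
theorem ScalarNet.collapse {n nₛ l : ℕ} (S : Sampling n nₛ l) (d : ℕ) (α : ℝ) {η γ : ℝ}
    (hη : 0 < η) (hγ : 0 < γ) (hγ1 : γ < 1) :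
    ∃ ψ, ScalarNet S d ψ ∧ (∀ x, α ≤ x → x ≤ α + (1 - γ) * η → ψ x = α) ∧
      (∀ x, x ≤ α → ψ x = x) ∧ ∀ x, α + η ≤ x → ψ x = x := by
  have hγη : 0 < γ * η := mul_pos hγ hη
  have hγη' : 0 < (1 - γ) * η := mul_pos (by linarith) hη
  -- The slopes are 1, 0, `1 / γ`, 1 in turn: the gap of length `γ * η` is stretched over the whole
  -- cell, so the graph rejoins the diagonal at `α + η`.
  refine ⟨fun x => x + (-max (x - α) 0 + 1 / γ * max (x - α - (1 - γ) * η) 0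
    - (1 - γ) / γ * max (x - α - η) 0), ScalarNet.residual S d
    ⟨![-1, 1 / γ, -((1 - γ) / γ), 0], ![1, 1, 1, 0], ![-α, -α - (1 - γ) * η, -α - η, 0],
      fun x => ?_⟩, fun x h1 h2 => ?_, fun x h => ?_, fun x h => ?_⟩
  · simp [Fin.sum_univ_four]
    ring_nf
  · simp only
    rw [max_eq_left (by linarith), max_eq_right (by linarith), max_eq_right (by nlinarith)]
    ring
  · simp only
    rw [max_eq_right (by linarith), max_eq_right (by linarith), max_eq_right (by linarith)]
    ring
  · simp only
    rw [max_eq_left (by linarith), max_eq_left (by nlinarith), max_eq_left (by linarith)]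
    field_simp
    ring

/-- Rounding down to a grid of mesh `η` on finitely many cells is a scalar net, except on a
proportion `γ` of each cell. -/
theorem ScalarNet.quantize {n nₛ l : ℕ} (S : Sampling n nₛ l) (d : ℕ) {η γ : ℝ}
    (hη : 0 < η) (hγ : 0 < γ) (hγ1 : γ < 1) (s : Finset ℤ) :
    ∃ ψ, ScalarNet S d ψ ∧ ∀ x, Int.fract (x / η) ≤ 1 - γ →
      ψ x = if ⌊x / η⌋ ∈ s then η * ⌊x / η⌋ else x := by
  induction s using Finset.induction_on with
  | empty => exact ⟨_, ScalarNet.id S d, fun x _ => by simp⟩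
  | insert j s hj ih =>
    obtain ⟨ψ, hψ, hψ'⟩ := ih
    obtain ⟨χ, hχ, hin, hle, hge⟩ := ScalarNet.collapse S d (η * j) hη hγ hγ1
    refine ⟨_, hχ.comp hψ, fun x hx => ?_⟩
    have hfl : x = η * ⌊x / η⌋ + η * Int.fract (x / η) := by
      rw [← mul_add, Int.floor_add_fract]; field_simp
    have hfr0 := mul_nonneg hη.le (Int.fract_nonneg (x / η))
    have hfr1 := mul_lt_mul_of_pos_left (Int.fract_lt_one (x / η)) hη
    have hfr2 := mul_le_mul_of_nonneg_left hx hη.le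
    -- Collapsing cell `j` fixes every point outside its interior, hence both the points of the
    -- other cells and the left ends to which earlier collapses sent them.
    have hcases : ∀ i : ℤ, i ≠ j → i < j ∧ η * i + η ≤ η * j ∨ j < i ∧ η * j + η ≤ η * i := by
      intro i hi
      rcases lt_or_gt_of_ne hi with h | h
      · refine Or.inl ⟨h, ?_⟩
        have : (i : ℝ) + 1 ≤ j := by exact_mod_cast h
        nlinarith
      · refine Or.inr ⟨h, ?_⟩
        have : (j : ℝ) + 1 ≤ i := by exact_mod_cast h
        nlinarith
    simp only [hψ' x hx]
    by_cases h : ⌊x / η⌋ = j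
    · have hs : ⌊x / η⌋ ∉ s := h ▸ hj
      rw [h] at hfl
      rw [if_neg hs, if_pos (by simp [h]), h]
      exact hin x (by linarith) (by linarith)
    · by_cases hs : ⌊x / η⌋ ∈ s
      · rw [if_pos hs, if_pos (by simp [hs])]
        rcases hcases _ h with h' | h'
        · exact hle _ (by linarith)
        · exact hge _ (by linarith)
      · rw [if_neg hs, if_neg (by simp [hs, h])]
        rcases hcases _ h with h' | h'
        · exact hle _ (by linarith)
        · exact hge _ (by linarith)

/-! ### Interpolation on finitely many tokens -/

/-- Finitely many hyperplanes do not cover a real vector space. -/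
theorem exists_dotProduct_ne_zero {d : ℕ} {ι : Type*} [Finite ι] (z : ι → Fin d → ℝ)
    (hz : ∀ i, z i ≠ 0) : ∃ u : Fin d → ℝ, ∀ i, u ⬝ᵥ z i ≠ 0 := by
  obtain ⟨f, hf⟩ := Module.exists_dual_forall_apply_ne_zero (K := ℝ) z hz
  refine ⟨(dotProductEquiv ℝ (Fin d)).symm f, fun i h => hf i ?_⟩
  rw [← dotProductEquiv_apply_apply (R := ℝ), LinearEquiv.apply_symm_apply] at h
  exact h

theorem fourReLU_hat (c : ℝ) {r : ℝ} (hr : 0 < r) :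
    ∃ h, FourReLU h ∧ h c = 1 ∧ ∀ x, r ≤ |x - c| → h x = 0 := by
  refine ⟨fun x => 1 / r * max (x - c + r) 0 - 2 / r * max (x - c) 0 + 1 / r * max (x - c - r) 0,
    ⟨![1 / r, -(2 / r), 1 / r, 0], ![1, 1, 1, 0], ![-c + r, -c, -c - r, 0], fun x => ?_⟩,
    ?_, fun x hx => ?_⟩
  · simp [Fin.sum_univ_four]
    ring_nf
  · simp only [sub_self, zero_add, zero_sub, max_self]
    rw [max_eq_left hr.le, max_eq_right (by linarith)]
    field_simp
    ring
  · simp only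
    rcases le_abs.1 hx with h | h
    · rw [max_eq_left (by linarith), max_eq_left (by linarith), max_eq_left (by linarith)]
      field_simp
      ring
    · rw [max_eq_right (by linarith), max_eq_right (by linarith), max_eq_right (by linarith)]
      ring

/-- A single point of a finite set can be moved anywhere, while the others stay. -/
theorem TokenNet.move {n nₛ l d : ℕ} (S : Sampling n nₛ l) {ι : Type*} [Finite ι]
    (z : ι → Fin d → ℝ) (x y : Fin d → ℝ) :
    ∃ φ, TokenNet S φ ∧ φ x = y ∧ ∀ i, z i ≠ x → φ (z i) = z i := by
  -- Along `u` the point `x` is isolated from the other points, so a ridge function with a narrow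
  -- hat at `u ⬝ᵥ x` moves `x` alone.
  obtain ⟨u, hu⟩ := exists_dotProduct_ne_zero (fun i : {i // z i ≠ x} => z i - x)
    (fun i => sub_ne_zero.2 i.2)
  have hr : ∀ᶠ r in nhdsWithin (0 : ℝ) (Set.Ioi 0),
      ∀ i : {i // z i ≠ x}, r < |u ⬝ᵥ (z i - x)| := by
    rw [Filter.eventually_all]
    exact fun i => (eventually_lt_nhds (abs_pos.2 (hu i))).filter_mono nhdsWithin_le_nhds
  obtain ⟨r, hr, hr0⟩ := (hr.and self_mem_nhdsWithin).exists
  obtain ⟨h, hh, h1, h0⟩ := fourReLU_hat (u ⬝ᵥ x) hr0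
  refine ⟨_, TokenNet.ridge S hh u (y - x), by simp [h1], fun i hi => ?_⟩
  have := (hr ⟨i, hi⟩).le
  rw [dotProduct_sub] at this
  simp [h0 _ this]

/-- The points are moved one at a time. Disjointness keeps a point that has already reached its
target from being picked up by a later move; targets may coincide. -/
theorem TokenNet.interpolate_of_disjoint {n nₛ l d : ℕ} (S : Sampling n nₛ l) {ι : Type*}
    [Finite ι] (x y : ι → Fin d → ℝ) (hx : Function.Injective x) (hxy : ∀ i j, x i ≠ y j) :
    ∃ φ, TokenNet S φ ∧ ∀ i, φ (x i) = y i := by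
  classical
  have := Fintype.ofFinite ι
  have key : ∀ s : Finset ι, ∃ φ, TokenNet S φ ∧ ∀ i, φ (x i) = if i ∈ s then y i else x i := by
    intro s
    induction s using Finset.induction_on with
    | empty => exact ⟨_, TokenNet.id S, fun i => by simp⟩
    | insert j s hj ih =>
      obtain ⟨φ, hφ, hφ'⟩ := ih
      obtain ⟨χ, hχ, hmove, hstay⟩ := TokenNet.move S (Sum.elim x y) (x j) (y j)
      refine ⟨_, hχ.comp hφ, fun i => ?_⟩
      simp only [hφ', Finset.mem_insert]
      by_cases hij : i = j
      · subst hij; simpa [hj] using hmove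
      · by_cases his : i ∈ s
        · simpa [his] using hstay (Sum.inr i) (hxy j i).symm
        · simpa [his, hij] using hstay (Sum.inl i) (hx.ne hij)
  simpa using key Finset.univ

/-- Token nets interpolate arbitrary finite data. -/
theorem TokenNet.interpolate {n nₛ l d : ℕ} (S : Sampling n nₛ l) (hd : 0 < d) {ι : Type*}
    [Finite ι] (x y : ι → Fin d → ℝ) (hx : Function.Injective x) :
    ∃ φ, TokenNet S φ ∧ ∀ i, φ (x i) = y i := by
  have : Nonempty (Fin d) := ⟨⟨0, hd⟩⟩
  have hfin : (Set.range (Sum.elim x y)).Finite := Set.finite_range _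
  have hinf : Infinite ↥(Set.range (Sum.elim x y))ᶜ := hfin.infinite_compl.to_subtype
  obtain ⟨m, ⟨e⟩⟩ := Finite.exists_equiv_fin ι
  -- Distinct intermediate positions away from all sources and targets; they exist because the token
  -- space is infinite for `d > 0`.
  let w : ι → Fin d → ℝ := fun i => Infinite.natEmbedding ↥(Set.range (Sum.elim x y))ᶜ (e i)
  have hw : Function.Injective w := fun i j h => by
    simpa [Fin.val_inj] using (Infinite.natEmbedding _).injective (Subtype.ext h)
  have hwmem : ∀ i k, Sum.elim x y k ≠ w i := fun i k h =>
    (Infinite.natEmbedding ↥(Set.range (Sum.elim x y))ᶜ (e i)).2 ⟨k, h⟩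
  obtain ⟨φ, hφ, h1⟩ :=
    TokenNet.interpolate_of_disjoint S x w hx fun i j => hwmem j (Sum.inl i)
  obtain ⟨χ, hχ, h2⟩ :=
    TokenNet.interpolate_of_disjoint S w y hw fun i j => (hwmem i (Sum.inr j)).symm
  exact ⟨_, hχ.comp hφ, fun i => by simp only [h1, h2]⟩

/-! ### Attention with uniform weights -/

/-- The linear map which averages the entries of each index set of the attention pattern. -/
noncomputable def nbrMean (nₛ : ℕ) : (Fin nₛ → ℝ) →ₗ[ℝ] Fin nₛ → ℝ where
  toFun y k := ∑ i ∈ hamiltonianPattern k, y i / (hamiltonianPattern k).card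
  map_add' y y' := by
    ext k
    simp [add_div, Finset.sum_add_distrib]
  map_smul' c y := by
    ext k
    simp [Finset.mul_sum, mul_div_assoc]

theorem nbrMean_apply {nₛ : ℕ} (y : Fin nₛ → ℝ) (k : Fin nₛ) :
    nbrMean nₛ y k = ∑ i ∈ hamiltonianPattern k, y i / (hamiltonianPattern k).card := rfl

theorem nbrMean_succ {nₛ : ℕ} (y : Fin nₛ → ℝ) (k k' : Fin nₛ) (h : k'.val = k.val + 1) :
    nbrMean nₛ y k = (y k + y k') / 2 := by
  have hp : hamiltonianPattern k = {k, k'} := by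
    ext j
    simp [hamiltonianPattern, Fin.ext_iff, h]
  have hne : k ≠ k' := by
    rintro rfl
    omega
  rw [nbrMean_apply, hp, Finset.sum_pair hne, Finset.card_pair hne]
  push_cast
  ring

theorem nbrMean_last {nₛ : ℕ} (y : Fin nₛ → ℝ) (k : Fin nₛ) (h : k.val + 1 = nₛ) :
    nbrMean nₛ y k = y k := by
  have hp : hamiltonianPattern k = {k} := by
    ext j
    have := j.isLt
    simp only [hamiltonianPattern, Finset.mem_filter, Finset.mem_univ, true_and,
      Finset.mem_singleton, Fin.ext_iff]
    omega
  simp [nbrMean_apply, hp]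

/-- The parameters of a block that adds to the coordinate `a` of each token `t` times its mean
over the attended tokens. -/
noncomputable def meanParams {d : ℕ} (a : Fin d) (t : ℝ) : BlockParams d 2 1 4 where
  WV _ := Matrix.of fun _ b => if b = a then 1 else 0
  WK := 0
  WQ := 0
  WO := Matrix.of fun b q => if b = a ∧ q.1 = 0 then t else 0
  W₁ := 0
  b₁ := 0
  W₂ := 0
  b₂ := 0

/-- Zero keys and queries make all scores equal, so the softmax is uniform; the output matrix
discards the second head. -/
theorem subAttn_meanParams {d nₛ : ℕ} (a : Fin d) (t : ℝ) (Y : Matrix (Fin d) (Fin nₛ) ℝ) :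
    subAttn (meanParams a t) Y a = Y a + t • nbrMean nₛ (Y a) := by
  ext k
  simp only [subAttn, Matrix.add_apply, Matrix.mul_apply, Fintype.sum_prod_type, Fin.sum_univ_two,
    sHead, meanParams, softmaxOn, nbrMean_apply, Pi.add_apply, Pi.smul_apply, smul_eq_mul]
  simp [div_eq_mul_inv]

/-- The increment of a row of the matrix of points in the `i`-th step of the attention with
uniform weights. -/
noncomputable def windowMean {n nₛ l : ℕ} (S : Sampling n nₛ l) (i : Fin l) :
    (Fin n → ℝ) →ₗ[ℝ] Fin n → ℝ :=
  Function.ExtendByZero.linearMap ℝ (S.window i) ∘ₗ nbrMean nₛ ∘ₗ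
    LinearMap.funLeft ℝ ℝ (S.window i)

theorem windowMean_window {n nₛ l : ℕ} (S : Sampling n nₛ l) (i : Fin l) (y : Fin n → ℝ)
    (k : Fin nₛ) : windowMean S i y (S.window i k) = nbrMean nₛ (y ∘ S.window i) k :=
  (S.window_injective i).extend_apply _ _ _

theorem windowMean_of_notMem {n nₛ l : ℕ} (S : Sampling n nₛ l) (i : Fin l) (y : Fin n → ℝ)
    (k : Fin n) (hk : ¬∃ j, S.window i j = k) : windowMean S i y k = 0 :=
  Function.extend_apply' _ _ _ hk

/-- The effect of the attention with uniform weights on a row. -/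
noncomputable def meanPass {n nₛ l : ℕ} (S : Sampling n nₛ l) (t : ℝ) (y : Fin n → ℝ) :
    Fin n → ℝ :=
  (List.finRange l).foldl (fun y i => y + t • windowMean S i y) y

theorem stb_meanParams {d n nₛ l : ℕ} (S : Sampling n nₛ l) (a : Fin d) (t : ℝ)
    (X : Matrix (Fin d) (Fin n) ℝ) : stb (meanParams a t) S X a = meanPass S t (X a) := by
  have hff : ∀ Z : Matrix (Fin d) (Fin n) ℝ, feedForward (meanParams a t) Z = Z := by
    intro Z
    ext b k
    simp [feedForward, meanParams]
  have hstep : ∀ i (Z : Matrix (Fin d) (Fin n) ℝ), sampledStep (meanParams a t) S i Z a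
      = Z a + t • windowMean S i (Z a) := by
    intro i Z
    ext k
    simp only [sampledStep, Matrix.of_apply, subAttn_meanParams, Pi.add_apply, Pi.smul_apply]
    by_cases hk : ∃ j, S.window i j = k
    · obtain ⟨j, rfl⟩ := hk
      rw [(S.window_injective i).extend_apply, windowMean_window]
      rfl
    · rw [Function.extend_apply' _ _ _ hk, windowMean_of_notMem S i _ k hk]
      simp
  rw [stb, hff, sAttn, meanPass]
  generalize List.finRange l = L
  induction L generalizing X with
  | nil => rfl
  | cons i L ih => rw [List.foldl_cons, List.foldl_cons, ih, hstep]

theorem meanPass_zero {n nₛ l : ℕ} (S : Sampling n nₛ l) (y : Fin n → ℝ) :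
    meanPass S 0 y = y := by
  simp [meanPass]

/-- The pass is a product of factors `1 + t A_i`, whose derivative at 0 is the sum of the `A_i`: to
first order the sequential overwriting of shared columns does not matter. -/
theorem hasDerivAt_meanPass {n nₛ l : ℕ} (S : Sampling n nₛ l) (y : Fin n → ℝ) :
    HasDerivAt (fun t => meanPass S t y) (∑ i, windowMean S i y) 0 := by
  have key : ∀ (L : List (Fin l)) (Y : ℝ → Fin n → ℝ) (Y' : Fin n → ℝ), HasDerivAt Y Y' 0 →
      HasDerivAt (fun t => L.foldl (fun y i => y + t • windowMean S i y) (Y t))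
        (Y' + (L.map fun i => windowMean S i (Y 0)).sum) 0 := by
    intro L
    induction L with
    | nil => intro Y Y' h; simpa using h
    | cons i L ih =>
      intro Y Y' h
      have hL : HasDerivAt (fun t => windowMean S i (Y t)) (windowMean S i Y') 0 :=
        (LinearMap.toContinuousLinearMap (windowMean S i)).hasFDerivAt.comp_hasDerivAt 0 h
      have h2 := ih _ _ (h.add ((hasDerivAt_id (0 : ℝ)).smul hL))
      simpa [add_assoc] using h2
  have h := key (List.finRange l) (fun _ => y) 0 (hasDerivAt_const _ _)
  rw [zero_add, ← List.ofFn_eq_map, List.sum_ofFn] at h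
  exact h

/-! ### Spreading information around the cycle of positions -/

/-- The cyclic enumeration of all indices in the order in which the windows visit them. -/
def Sampling.cycle {n nₛ l : ℕ} (S : Sampling n nₛ l) (hl : 0 < l) (x : ℕ) : Fin n :=
  S.R ⟨x / (nₛ - 1) % l, Nat.mod_lt _ hl⟩
    ⟨x % (nₛ - 1), Nat.mod_lt _ (Nat.sub_pos_of_lt S.two_le)⟩

theorem Sampling.R_bijective {n nₛ l : ℕ} (S : Sampling n nₛ l) :
    Function.Bijective (fun q : Fin l × Fin (nₛ - 1) => S.R q.1 q.2) := by
  rw [Fintype.bijective_iff_injective_and_card]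
  refine ⟨fun q q' h => Prod.ext_iff.2 (S.distinct _ _ _ _ h), ?_⟩
  simp [← S.card, mul_comm]

theorem Sampling.exists_cycle_eq {n nₛ l : ℕ} (S : Sampling n nₛ l) (hl : 0 < l) (k : Fin n) :
    ∃ x < n, S.cycle hl x = k := by
  obtain ⟨⟨i, j⟩, rfl⟩ := S.R_bijective.2 k
  have hi := i.isLt
  have hj := j.isLt
  have hm : 0 < nₛ - 1 := Nat.sub_pos_of_lt S.two_le
  refine ⟨i * (nₛ - 1) + j, ?_, ?_⟩
  · have := S.card
    have : (i + 1) * (nₛ - 1) ≤ l * (nₛ - 1) := Nat.mul_le_mul_right _ hi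
    nlinarith
  · have h1 : (i.val * (nₛ - 1) + j) / (nₛ - 1) % l = i := by
      rw [mul_comm, Nat.mul_add_div hm, Nat.div_eq_of_lt hj, add_zero, Nat.mod_eq_of_lt hi]
    have h2 : (i.val * (nₛ - 1) + j) % (nₛ - 1) = j := by
      rw [mul_comm, Nat.mul_add_mod, Nat.mod_eq_of_lt hj]
    simp only [cycle, h1, h2]

theorem Sampling.cycle_add_period {n nₛ l : ℕ} (S : Sampling n nₛ l) (hl : 0 < l) (x : ℕ) :
    S.cycle hl (x + n) = S.cycle hl x := by
  have hm : 0 < nₛ - 1 := Nat.sub_pos_of_lt S.two_le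
  have h1 : (x + n) / (nₛ - 1) % l = x / (nₛ - 1) % l := by
    rw [← S.card, Nat.add_mul_div_left _ _ hm, Nat.add_mod_right]
  have h2 : (x + n) % (nₛ - 1) = x % (nₛ - 1) := by
    rw [← S.card, Nat.add_mul_mod_self_left]
  simp only [cycle, h1, h2]

/-- The final slot of a window is the first index of the next set, so even a pair straddling two
index sets is adjacent in one window. -/
theorem Sampling.exists_window_eq_cycle {n nₛ l : ℕ} (S : Sampling n nₛ l) (hl : 0 < l) (x : ℕ) :
    ∃ (i : Fin l) (j j' : Fin nₛ), j'.val = j.val + 1 ∧ S.window i j = S.cycle hl x ∧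
      S.window i j' = S.cycle hl (x + 1) := by
  have h2 := S.two_le
  have hm : 0 < nₛ - 1 := Nat.sub_pos_of_lt h2
  have hj := Nat.mod_lt x hm
  have hx := Nat.div_add_mod x (nₛ - 1)
  refine ⟨⟨x / (nₛ - 1) % l, Nat.mod_lt _ hl⟩, ⟨x % (nₛ - 1), by omega⟩,
    ⟨x % (nₛ - 1) + 1, by omega⟩, rfl, ?_, ?_⟩
  · rw [window, dif_pos hj]
    rfl
  · by_cases h : x % (nₛ - 1) + 1 < nₛ - 1
    · have e1 : (x + 1) / (nₛ - 1) = x / (nₛ - 1) := by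
        conv_lhs => rw [← hx, add_assoc, Nat.mul_add_div hm, Nat.div_eq_of_lt h, add_zero]
      have e2 : (x + 1) % (nₛ - 1) = x % (nₛ - 1) + 1 := by
        conv_lhs => rw [← hx, add_assoc, Nat.mul_add_mod, Nat.mod_eq_of_lt h]
      rw [window, dif_pos h]
      simp only [cycle, e1, e2]
    · have e : x + 1 = (nₛ - 1) * (x / (nₛ - 1) + 1) := by
        rw [mul_add]; omega
      rw [window, dif_neg h]
      simp only [first, next, cycle, e, Nat.mul_div_cancel_left _ hm, Nat.mul_mod_right,
        Nat.mod_add_mod]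

/-- A small step of uniform attention keeps what distinguishes finitely many rows and lets each
entry determine its own old value and that of its successor in the cycle. -/
theorem exists_meanPass_separates {n nₛ l : ℕ} (S : Sampling n nₛ l) (hl : 0 < l) {ι : Type*}
    [Finite ι] (y : ι → Fin n → ℝ) (hy : ∀ q q' k k', y q k = y q' k' → k = k') :
    ∃ t : ℝ, ∀ q q' k k', meanPass S t (y q) k = meanPass S t (y q') k' →
      k = k' ∧ y q k = y q' k ∧
        ∀ x, S.cycle hl x = k → y q (S.cycle hl (x + 1)) = y q' (S.cycle hl (x + 1)) := by
  have hderiv : ∀ q k, HasDerivAt (fun t => meanPass S t (y q) k)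
      ((∑ i, windowMean S i (y q)) k) 0 := fun q k =>
    (hasDerivAt_pi.1 (hasDerivAt_meanPass S (y q))) k
  suffices h : ∀ᶠ t in nhdsWithin (0 : ℝ) {0}ᶜ, ∀ q q' k k',
      meanPass S t (y q) k = meanPass S t (y q') k' → k = k' ∧ y q k = y q' k ∧
        ∀ x, S.cycle hl x = k → y q (S.cycle hl (x + 1)) = y q' (S.cycle hl (x + 1)) from h.exists
  simp only [Filter.eventually_all]
  intro q q' k k'
  have hsub := (hderiv q k).sub (hderiv q' k')
  by_cases hne : y q k = y q' k'
  · obtain rfl := hy _ _ _ _ hne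
    by_cases hx : ∀ x, S.cycle hl x = k → y q (S.cycle hl (x + 1)) = y q' (S.cycle hl (x + 1))
    · exact Filter.Eventually.of_forall fun t _ => ⟨rfl, hne, hx⟩
    · push Not at hx
      obtain ⟨x, rfl, hx⟩ := hx
      -- The values agree at this position but not at its successor; the derivatives then differ by
      -- half the difference `δ` at the successor.
      have hd : (∑ i, windowMean S i (y q)) (S.cycle hl x)
          - (∑ i, windowMean S i (y q')) (S.cycle hl x) ≠ 0 := by
        set δ := y q - y q' with hδ
        have h0 : δ (S.cycle hl x) = 0 := by simp [hδ, hne]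
        have h1 : δ (S.cycle hl (x + 1)) ≠ 0 := by simpa [hδ, sub_eq_zero] using hx
        obtain ⟨i, j, j', hjj, hw, hw'⟩ := S.exists_window_eq_cycle hl x
        have hsum : (∑ i, windowMean S i (y q)) (S.cycle hl x)
            - (∑ i, windowMean S i (y q')) (S.cycle hl x)
            = ∑ i, windowMean S i δ (S.cycle hl x) := by
          simp [hδ, map_sub, Finset.sum_apply]
        rw [hsum, Finset.sum_eq_single i]
        · rw [← hw, windowMean_window, nbrMean_succ _ j j' hjj]
          simp [hw, hw', h0, h1]
        -- By disjointness another window can meet this position only in its last slot, which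
        -- averages over itself alone and so contributes `δ = 0`.
        · intro i' _ hi'
          by_cases hk : ∃ m, S.window i' m = S.cycle hl x
          · obtain ⟨m, hm⟩ := hk
            rw [← hm, windowMean_window, nbrMean_last _ m]
            · simp [hm, h0]
            · by_contra hlast
              have h2 := m.isLt
              have h3 := j'.isLt
              rw [← hw, Sampling.window, Sampling.window, dif_pos (by omega),
                dif_pos (by omega)] at hm
              exact hi' (S.distinct _ _ _ _ hm).1
          · exact windowMean_of_notMem S i' δ _ hk
        · simp
      filter_upwards [hsub.eventually_ne (c := 0) hd] with t ht h
      exact absurd (sub_eq_zero.2 h) ht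
  -- Entries that differ at `t = 0` still differ for small `t`, by continuity.
  · have hc : ∀ᶠ t in nhds (0 : ℝ), meanPass S t (y q) k - meanPass S t (y q') k' ≠ 0 := by
      refine hsub.continuousAt.eventually_ne ?_
      simpa [meanPass_zero, sub_eq_zero] using hne
    filter_upwards [hc.filter_mono nhdsWithin_le_nhds] with t ht h
    exact absurd (sub_eq_zero.2 h) ht

/-- Repeated attention with uniform weights lets every entry of a row determine the entries at
the following positions of the cycle. -/
theorem exists_realizable_separates {d n nₛ l : ℕ} (S : Sampling n nₛ l) (hl : 0 < l) (a : Fin d)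
    {ι : Type*} [Finite ι] (X : ι → Matrix (Fin d) (Fin n) ℝ)
    (hX : ∀ q q' k k', X q a k = X q' a k' → k = k') (N : ℕ) :
    ∃ g, Realizable S g ∧ ∀ q q' k k', g (X q) a k = g (X q') a k' → k = k' ∧
      ∀ x, S.cycle hl x = k → ∀ i ≤ N, X q a (S.cycle hl (x + i)) = X q' a (S.cycle hl (x + i)) := by
  induction N with
  | zero =>
    refine ⟨_, Realizable.id S, fun q q' k k' h => ?_⟩
    obtain rfl := hX _ _ _ _ h
    refine ⟨rfl, ?_⟩
    rintro x rfl i hi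
    obtain rfl : i = 0 := by omega
    exact h
  | succ N ih =>
    obtain ⟨g, hg, hsep⟩ := ih
    obtain ⟨t, ht⟩ := exists_meanPass_separates S hl (fun q => g (X q) a)
      fun q q' k k' h => (hsep q q' k k' h).1
    have hstb : Realizable S (stb (d := d) (meanParams a t) S) := ⟨[meanParams a t], fun _ => rfl⟩
    refine ⟨_, hstb.comp hg, fun q q' k k' h => ?_⟩
    simp only [stb_meanParams] at h
    obtain ⟨rfl, h0, h1⟩ := ht q q' k k' h
    refine ⟨rfl, fun x hx i hi => ?_⟩
    -- Offset 0 comes from the old entry itself, a positive offset from the old entry at the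
    -- successor, with the offset lowered by one.
    rcases Nat.eq_zero_or_pos i with rfl | hpos
    · exact (hsep q q' k k h0).2 x hx 0 (Nat.zero_le _)
    · obtain ⟨i, rfl⟩ := Nat.exists_eq_add_of_lt hpos
      have := (hsep q q' _ _ (h1 x hx)).2 (x + 1) rfl i (by omega)
      rwa [show x + (0 + i + 1) = x + 1 + i by ring]

/-! ### Interpolation on finitely many matrices -/

/-- Sampled transformers interpolate arbitrary data on finitely many matrices, provided that
columns in different positions are different. -/
theorem Realizable.interpolate {d n nₛ l : ℕ} (S : Sampling n nₛ l) (hd : 0 < d) (hl : 0 < l)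
    {ι : Type*} [Finite ι] (X F : ι → Matrix (Fin d) (Fin n) ℝ) (hX : Function.Injective X)
    (hpos : ∀ q q' k k', (X q).col k = (X q').col k' → k = k') :
    ∃ g, Realizable S g ∧ ∀ q, g (X q) = F q := by
  let a : Fin d := ⟨0, hd⟩
  let T : Set (Fin d → ℝ) := Set.range fun p : ι × Fin n => (X p.1).col p.2
  have hT : Finite T := Set.finite_range _
  obtain ⟨m, ⟨e⟩⟩ := Finite.exists_equiv_fin T
  obtain ⟨φ, hφ, hφe⟩ := TokenNet.interpolate S hd (fun x : T => x.1)
    (fun x _ => ((e x).val : ℝ)) Subtype.val_injective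
  have hcode : ∀ q q' k k', colMap φ (X q) a k = colMap φ (X q') a k' →
      (X q).col k = (X q').col k' := by
    intro q q' k k' h
    have h1 := congrFun (hφe ⟨(X q).col k, (q, k), rfl⟩) a
    have h2 := congrFun (hφe ⟨(X q').col k', (q', k'), rfl⟩) a
    have h3 := (h1.symm.trans h).trans h2
    have h4 := e.injective (Fin.ext (Nat.cast_injective h3))
    exact congrArg Subtype.val h4
  -- From index `x < n`, the index `x' < n` is reached after `x' + n - x` steps; adding a full
  -- period keeps this nonnegative, and `2 * n` bounds it.
  obtain ⟨g, hg, hsep⟩ := exists_realizable_separates S hl a (fun q => colMap φ (X q))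
    (fun q q' k k' h => hpos q q' k k' (hcode q q' k k' h)) (2 * n)
  obtain ⟨χ, hχ, hχF⟩ := TokenNet.interpolate S hd
    (fun p : ι × Fin n => (g (colMap φ (X p.1))).col p.2) (fun p => (F p.1).col p.2) (by
      rintro ⟨q, k⟩ ⟨q', k'⟩ h
      obtain ⟨rfl, h'⟩ := hsep q q' k k' (congrFun h a)
      obtain ⟨x, hx, hxk⟩ := S.exists_cycle_eq hl k
      obtain rfl : q = q' := by
        refine hX (Matrix.ext_col fun k' => ?_)
        obtain ⟨x', hx', rfl⟩ := S.exists_cycle_eq hl k'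
        have := h' x hxk (x' + n - x) (by omega)
        rw [show x + (x' + n - x) = x' + n by omega, S.cycle_add_period] at this
        exact hcode _ _ _ _ this
      rfl)
  refine ⟨_, Realizable.comp (g' := colMap χ) hχ (hg.comp (g := colMap φ) hφ), fun q => ?_⟩
  exact Matrix.ext_col fun k => hχF (q, k)

/-! ### Positional embedding and approximation on grid cells -/

/-- A positional embedding can shift different positions arbitrarily far apart. -/
theorem exists_positional_embedding {d n : ℕ} (P : Matrix (Fin 3) (Fin n) ℝ)
    (hP : Function.Injective P.col) (M : ℝ) :
    ∃ Wp : Matrix (Fin d) (Fin 3) ℝ, ∀ a k k', k ≠ k' → M ≤ |(Wp * P) a k - (Wp * P) a k'| := by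
  obtain ⟨u, hu⟩ := exists_dotProduct_ne_zero
    (fun q : {q : Fin n × Fin n // q.1 ≠ q.2} => P.col q.1.1 - P.col q.1.2)
    (fun q => sub_ne_zero.2 (hP.ne q.2))
  have hc : ∀ᶠ c in Filter.atTop, ∀ q : {q : Fin n × Fin n // q.1 ≠ q.2},
      M ≤ c * |u ⬝ᵥ (P.col q.1.1 - P.col q.1.2)| := by
    rw [Filter.eventually_all]
    exact fun q => (Filter.tendsto_id.atTop_mul_const (abs_pos.2 (hu q))).eventually_ge_atTop M
  obtain ⟨c, hc, hc0⟩ := (hc.and (Filter.eventually_ge_atTop 0)).exists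
  refine ⟨Matrix.of fun _ => c • u, fun a k k' hk => (hc ⟨(k, k'), hk⟩).trans_eq ?_⟩
  have h : ∀ k, ((Matrix.of fun _ => c • u : Matrix (Fin d) (Fin 3) ℝ) * P) a k
      = c * (u ⬝ᵥ P.col k) := by
    intro k
    rw [← smul_eq_mul, ← smul_dotProduct]
    rfl
  rw [h, h, ← mul_sub, abs_mul, abs_of_nonneg hc0, dotProduct_sub]

/-- Approximation, up to the modulus of continuity `δ` at scale `η`, outside of small gaps
between the cells of a grid. -/
theorem exists_approx_off_gaps {d n nₛ l : ℕ} (S : Sampling n nₛ l) (hd : 0 < d) (hl : 0 < l)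
    (P : Matrix (Fin 3) (Fin n) ℝ) (D : Set (Matrix (Fin d) (Fin n) ℝ))
    (f : Matrix (Fin d) (Fin n) ℝ → Matrix (Fin d) (Fin n) ℝ) (Wp : Matrix (Fin d) (Fin 3) ℝ)
    {η δ B M γ : ℝ} (hη : 0 < η) (hB : 0 ≤ B) (hγ : 0 < γ) (hγ1 : γ < 1)
    (hM : ∀ X ∈ D, ∀ a k, |(X + Wp * P) a k| ≤ M)
    (hsep : ∀ X ∈ D, ∀ X' ∈ D, ∀ a k k', k ≠ k' → η ≤ |(X + Wp * P) a k - (X' + Wp * P) a k'|)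
    (hfB : ∀ X ∈ D, ∀ a k, |f X a k| ≤ B)
    (hfδ : ∀ X ∈ D, ∀ X' ∈ D, (∀ a k, |X a k - X' a k| < η) → ∀ a k, |f X a k - f X' a k| ≤ δ) :
    ∃ g ∈ sampledTransformers S P d 2 1 4, (∀ X a k, |g X a k| ≤ B) ∧
      ∀ X ∈ D, (∀ a k, Int.fract ((X + Wp * P) a k / η) ≤ 1 - γ) →
        ∀ a k, |f X a k - g X a k| ≤ δ := by
  let J : ℤ := ⌈M / η⌉ + 1
  let cell : Matrix (Fin d) (Fin n) ℝ → Fin d → Fin n → ℤ :=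
    fun X a k => ⌊(X + Wp * P) a k / η⌋
  have hJ : ∀ X ∈ D, ∀ a k, cell X a k ∈ Finset.Icc (-J) J := by
    intro X hX a k
    have h1 := abs_le.1 (hM X hX a k)
    have h2 : (X + Wp * P) a k / η ≤ M / η := by gcongr; exact h1.2
    have h3 : -(M / η) ≤ (X + Wp * P) a k / η := by rw [← neg_div]; gcongr; exact h1.1
    have h4 := Int.le_ceil (M / η)
    rw [Finset.mem_Icc]
    constructor
    · rw [Int.le_floor]
      push_cast [J]
      linarith
    · rw [← Int.lt_add_one_iff, Int.floor_lt]
      push_cast [J]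
      linarith
  have hfin : (cell '' D).Finite := by
    refine (Set.finite_Icc (fun _ _ => -J) (fun _ _ => J)).subset ?_
    rintro _ ⟨X, hX, rfl⟩
    exact ⟨fun a k => (Finset.mem_Icc.1 (hJ X hX a k)).1,
      fun a k => (Finset.mem_Icc.1 (hJ X hX a k)).2⟩
  have hclose : ∀ {x y : ℝ}, ⌊x / η⌋ = ⌊y / η⌋ → |x - y| < η := by
    intro x y h
    have := Int.abs_sub_lt_one_of_floor_eq_floor h
    rwa [← sub_div, abs_div, abs_of_pos hη, div_lt_one hη] at this
  have : Finite (cell '' D) := hfin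
  choose rep hrep using fun q : cell '' D => q.2
  obtain ⟨ψ, hψ, hψ'⟩ := ScalarNet.quantize S d hη hγ hγ1 (Finset.Icc (-J) J)
  obtain ⟨χ, hχ, hχB, hχid⟩ := ScalarNet.clip S d hB
  obtain ⟨g, hg, hgF⟩ := Realizable.interpolate S hd hl
    (fun q : cell '' D => Matrix.of fun a k => η * (q.1 a k : ℝ)) (fun q => f (rep q)) (by
      intro q q' h
      refine Subtype.ext (funext fun a => funext fun k => ?_)
      have := congrFun (congrFun h a) k
      simpa [hη.ne'] using this) (by
      -- Equal columns in different positions would put two entries in the same cell, at distance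
      -- less than `η`, against the separation `hsep`.
      intro q q' k k' h
      by_contra hk
      have h0 := congrFun h ⟨0, hd⟩
      simp only [Matrix.col_apply, Matrix.of_apply, mul_eq_mul_left_iff, Int.cast_inj,
        hη.ne', or_false] at h0
      rw [← (hrep q).2, ← (hrep q').2] at h0
      exact absurd (hclose h0)
        (not_lt.2 (hsep _ (hrep q).1 _ (hrep q').1 ⟨0, hd⟩ k k' hk)))
  -- Quantize, interpolate, clip. The clip leaves the values of `f` on `D` unchanged and bounds the
  -- output on the gaps, where it is otherwise uncontrolled.
  obtain ⟨blocks, hblocks⟩ := Realizable.comp (g' := colMap fun x a => χ (x a)) hχ.tokenNet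
    (hg.comp (g := colMap fun x a => ψ (x a)) hψ.tokenNet)
  refine ⟨_, ⟨Wp, blocks, fun X => rfl⟩, fun X a k => ?_, fun X hX hgood a k => ?_⟩
  · rw [hblocks]
    exact hχB _
  · rw [hblocks]
    let q : cell '' D := ⟨cell X, X, hX, rfl⟩
    have hquant : colMap (fun x a => ψ (x a)) (X + Wp * P)
        = Matrix.of fun a k => η * (q.1 a k : ℝ) := by
      ext a k
      refine (hψ' _ (hgood a k)).trans ?_
      exact if_pos (hJ X hX a k)
    beta_reduce
    rw [hquant, hgF q]
    have hclip : colMap (fun x a => χ (x a)) (f (rep q)) a k = f (rep q) a k :=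
      hχid _ (hfB _ (hrep q).1 a k)
    rw [hclip]
    refine hfδ X hX _ (hrep q).1 (fun a k => ?_) a k
    have h1 : cell (rep q) a k = cell X a k := congrFun (congrFun (hrep q).2 a) k
    have := hclose h1.symm
    simpa using this

/-! ### Measure of the gaps and the error integral -/

/-- The points with an entry in one of the gaps, which take a proportion `1 / (N + 2)` of each
cell. -/
def gapSet {d n : ℕ} (W : Matrix (Fin d) (Fin n) ℝ) (η : ℝ) (N : ℕ) :
    Set (Fin d → Fin n → ℝ) :=
  {X | ∃ a k, 1 - 1 / ((N : ℝ) + 2) < Int.fract ((Matrix.of X + W) a k / η)}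

theorem measurableSet_gapSet {d n : ℕ} (W : Matrix (Fin d) (Fin n) ℝ) (η : ℝ) (N : ℕ) :
    MeasurableSet (gapSet W η N) := by
  simp only [gapSet, Set.ofPred_exists]
  refine MeasurableSet.iUnion fun a => MeasurableSet.iUnion fun k =>
    measurableSet_lt measurable_const (measurable_fract.comp ?_)
  simp only [Matrix.add_apply, Matrix.of_apply]
  fun_prop

/-- The gap sets decrease, and their intersection is empty because fractional parts are strictly
below 1; continuity from above does the rest, with no volume computed. -/
theorem tendsto_measure_gapSet {d n : ℕ} (W : Matrix (Fin d) (Fin n) ℝ) (η : ℝ)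
    (μ : Measure (Fin d → Fin n → ℝ)) [IsFiniteMeasure μ] :
    Filter.Tendsto (fun N => μ (gapSet W η N)) Filter.atTop (nhds 0) := by
  have hanti : Antitone (gapSet W η) := by
    rintro N N' h X ⟨a, k, hX⟩
    refine ⟨a, k, lt_of_le_of_lt ?_ hX⟩
    gcongr
  have hempty : ⋂ N, gapSet W η N = ∅ := by
    refine Set.eq_empty_of_forall_notMem fun X hX => ?_
    have hlim : Filter.Tendsto (fun N : ℕ => 1 - 1 / ((N : ℝ) + 2)) Filter.atTop (nhds 1) := by
      have h : Filter.Tendsto (fun N : ℕ => (N : ℝ) + 2) Filter.atTop Filter.atTop :=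
        Filter.tendsto_atTop_add_const_right _ _ tendsto_natCast_atTop_atTop
      simpa using (tendsto_const_nhds (x := (1 : ℝ))).sub (h.inv_tendsto_atTop)
    have hev : ∀ᶠ N : ℕ in Filter.atTop,
        ∀ a k, Int.fract ((Matrix.of X + W) a k / η) < 1 - 1 / ((N : ℝ) + 2) := by
      simp only [Filter.eventually_all]
      exact fun a k => hlim.eventually_const_lt (Int.fract_lt_one _)
    obtain ⟨N, hN⟩ := hev.exists
    obtain ⟨a, k, h⟩ := Set.mem_iInter.1 hX N
    exact absurd h (not_lt.2 (hN a k).le)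
  have := tendsto_measure_iInter_atTop (μ := μ)
    (fun N => (measurableSet_gapSet W η N).nullMeasurableSet) hanti ⟨0, measure_ne_top _ _⟩
  rwa [hempty, measure_empty] at this

/-- The integrand is dominated by a constant plus a multiple of the indicator of `G`, so no
measurability of `f` or `g` is needed. -/
theorem lpDist_le_of_gaps {d n : ℕ} {p : ℝ} (hp : 1 ≤ p) {D : Set (Matrix (Fin d) (Fin n) ℝ)}
    (hD : MeasurableSet (Matrix.of ⁻¹' D))
    {f g : Matrix (Fin d) (Fin n) ℝ → Matrix (Fin d) (Fin n) ℝ}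
    {G : Set (Fin d → Fin n → ℝ)} (hG : MeasurableSet G) {δ B : ℝ}
    (hδ : ∀ X ∈ D, X ∉ G → ∀ a k, |f X a k - g X a k| ≤ δ)
    (hB : ∀ X ∈ D, ∀ a k, |f X a k - g X a k| ≤ B) :
    lpDist p D f g ≤ (ENNReal.ofReal (∑ _a : Fin d, ∑ _k : Fin n, δ ^ p) *
        volume (Matrix.of ⁻¹' D : Set (Fin d → Fin n → ℝ)) +
      ENNReal.ofReal (∑ _a : Fin d, ∑ _k : Fin n, B ^ p) *
        volume.restrict (Matrix.of ⁻¹' D) G) ^ (1 / p) := by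
  have hp0 : 0 ≤ p := by linarith
  refine ENNReal.rpow_le_rpow ?_ (by positivity)
  calc _ ≤ ∫⁻ X in Matrix.of ⁻¹' D, (ENNReal.ofReal (∑ _a : Fin d, ∑ _k : Fin n, δ ^ p) +
        G.indicator (fun _ => ENNReal.ofReal (∑ _a : Fin d, ∑ _k : Fin n, B ^ p)) X) := by
        refine setLIntegral_mono' hD fun X hX => ?_
        by_cases hXG : X ∈ G
        · rw [Set.indicator_of_mem hXG]
          refine le_add_left (ENNReal.ofReal_le_ofReal ?_)
          gcongr with a _ k _
          exact hB _ hX a k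
        · refine le_add_right (ENNReal.ofReal_le_ofReal ?_)
          gcongr with a _ k _
          exact hδ _ hX hXG a k
    _ = _ := by
        rw [lintegral_add_left measurable_const, lintegral_const, lintegral_indicator_const hG,
          Measure.restrict_apply_univ]

end SampledTransformer

/-! ### Choice of the parameters -/

open SampledTransformer in
theorem mainTheorem1 (d n nₛ l : ℕ) (S : SampledTransformer.Sampling n nₛ l)
    (P : Matrix (Fin 3) (Fin n) ℝ) (hP : Function.Injective P.col)
    (p : ℝ) (hp : 1 ≤ p)
    (D : Set (Matrix (Fin d) (Fin n) ℝ)) (hD : IsCompact D)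
    (f : Matrix (Fin d) (Fin n) ℝ → Matrix (Fin d) (Fin n) ℝ) (hf : ContinuousOn f D)
    (ε : ℝ) (hε : 0 < ε) :
    ∃ g ∈ SampledTransformer.sampledTransformers S P d 2 1 4,
      SampledTransformer.lpDist p D f g ≤ ENNReal.ofReal ε := by
  have hp0 : 0 < p := by linarith
  rcases Nat.eq_zero_or_pos d with rfl | hd
  · refine ⟨fun X => X + (0 : Matrix (Fin 0) (Fin 3) ℝ) * P, ⟨0, [], fun X => rfl⟩, ?_⟩
    simp [lpDist, hp0]
  have hl : 0 < l := by
    have h1 := S.card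
    have h2 := S.two_le
    have h3 := S.le
    rcases Nat.eq_zero_or_pos l with rfl | h
    · omega
    · exact h
  have hD' : IsCompact (Matrix.of ⁻¹' D : Set (Fin d → Fin n → ℝ)) := hD
  have hmeas := hD'.measurableSet
  have hfin : IsFiniteMeasure
      ((volume : Measure (Fin d → Fin n → ℝ)).restrict (Matrix.of ⁻¹' D)) :=
    isFiniteMeasure_restrict.2 hD'.measure_lt_top.ne
  have hbdd : ∀ K : Set (Fin d → Fin n → ℝ), IsCompact K →
      ∃ B : ℝ, 0 ≤ B ∧ ∀ X ∈ K, ∀ a k, |X a k| ≤ B := by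
    intro K hK
    obtain ⟨B, hB, h⟩ := hK.isBounded.exists_pos_norm_le
    exact ⟨B, hB.le, fun X hX a k =>
      ((norm_le_pi_norm (X a) k).trans (norm_le_pi_norm X a)).trans (h X hX)⟩
  obtain ⟨M, -, hM⟩ := hbdd _ hD'
  obtain ⟨B, hB0, hB⟩ := hbdd (f '' D) (hD.image_of_continuousOn hf)
  -- Half of `ε ^ p` is allotted to the cells, which fixes `δ` and then `η`; the other half to the
  -- gaps, which fixes `N` last.
  have hεp : (ENNReal.ofReal ε ^ p / 2) ≠ 0 := by
    simp [hε]
  have hlimδ : Filter.Tendsto (fun δ : ℝ => ENNReal.ofReal (∑ _a : Fin d, ∑ _k : Fin n, δ ^ p) *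
      volume (Matrix.of ⁻¹' D : Set (Fin d → Fin n → ℝ))) (nhdsWithin 0 (Set.Ioi 0)) (nhds 0) := by
    have hc : Continuous fun δ : ℝ => ∑ _a : Fin d, ∑ _k : Fin n, δ ^ p := by
      have := Real.continuous_rpow_const hp0.le
      fun_prop
    have h := ENNReal.Tendsto.mul_const (ENNReal.tendsto_ofReal (hc.tendsto 0))
      (Or.inr (hD'.measure_lt_top (μ := volume)).ne)
    simp only [Real.zero_rpow hp0.ne', Finset.sum_const_zero, ENNReal.ofReal_zero, zero_mul] at h
    exact h.mono_left nhdsWithin_le_nhds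
  obtain ⟨δ, hδ, hδ0⟩ :=
    ((hlimδ.eventually_le_const (pos_iff_ne_zero.2 hεp)).and self_mem_nhdsWithin).exists
  have huc := hD'.uniformContinuousOn_of_continuous
    (f := fun X => (Matrix.of.symm (f (Matrix.of X)) : Fin d → Fin n → ℝ)) hf
  obtain ⟨η, hη, hfη⟩ := Metric.uniformContinuousOn_iff.1 huc δ hδ0
  -- Entries of matrices in `D` differ by at most `2 * M`, so this shift leaves a distance of at
  -- least `η` between positions.
  obtain ⟨Wp, hWp⟩ := exists_positional_embedding (d := d) P hP (2 * M + η)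
  obtain ⟨M', -, hM'⟩ := hbdd ((fun X => X + Wp * P) '' D)
    (hD.image_of_continuousOn (continuous_id.add continuous_const).continuousOn)
  have hlimN := ENNReal.Tendsto.const_mul
    (a := ENNReal.ofReal (∑ _a : Fin d, ∑ _k : Fin n, (2 * B) ^ p))
    (tendsto_measure_gapSet (Wp * P) η (volume.restrict (Matrix.of ⁻¹' D)))
    (Or.inr ENNReal.ofReal_ne_top)
  rw [mul_zero] at hlimN
  obtain ⟨N, hN⟩ := (hlimN.eventually_le_const (pos_iff_ne_zero.2 hεp)).exists
  have hN2 : (0 : ℝ) < (N : ℝ) + 2 := by positivity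
  obtain ⟨g, hg, hgB, hgδ⟩ := exists_approx_off_gaps S hd hl P D f Wp (η := η) (δ := δ) (B := B)
    (M := M') (γ := 1 / ((N : ℝ) + 2)) hη hB0 (by positivity)
    (by rw [div_lt_one hN2]; linarith [Nat.cast_nonneg (α := ℝ) N])
    (fun X hX => hM' _ ⟨X, hX, rfl⟩) (fun X hX X' hX' a k k' hk => by
      have h1 := hWp a k k' hk
      have h2 := abs_le.1 (hM X hX a k)
      have h3 := abs_le.1 (hM X' hX' a k')
      rw [Matrix.add_apply, Matrix.add_apply]
      rcases le_abs.1 h1 with h | h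
      · exact le_abs.2 (Or.inl (by linarith))
      · exact le_abs.2 (Or.inr (by linarith)))
    (fun X hX => hB _ ⟨X, hX, rfl⟩) (fun X hX X' hX' h a k => by
      have h1 : dist (Matrix.of.symm X) (Matrix.of.symm X') < η :=
        (dist_pi_lt_iff hη).2 fun a => (dist_pi_lt_iff hη).2 fun k => h a k
      have h2 := hfη _ hX _ hX' h1
      exact (dist_pi_le_iff hδ0.le).1 ((dist_pi_le_iff hδ0.le).1 h2.le a) k)
  refine ⟨g, hg, (lpDist_le_of_gaps hp hmeas (measurableSet_gapSet (Wp * P) η N) (δ := δ)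
    (B := 2 * B) (fun X hX hgap => ?_) (fun X hX a k => ?_)).trans ?_⟩
  · refine hgδ X hX fun a k => ?_
    by_contra h
    exact hgap ⟨a, k, not_le.1 h⟩
  · have h1 := hB _ ⟨X, hX, rfl⟩ a k
    have h2 := hgB X a k
    exact (abs_sub _ _).trans (by linarith)
  · calc _ ≤ (ENNReal.ofReal ε ^ p / 2 + ENNReal.ofReal ε ^ p / 2) ^ (1 / p) :=
          ENNReal.rpow_le_rpow (add_le_add hδ hN) (by positivity)
      _ = ENNReal.ofReal ε := by
          rw [ENNReal.add_halves, one_div, ENNReal.rpow_rpow_inv hp0.ne']
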